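/- For $t\in\mathbb{R}$ let $(t)_0=1$, $(t)_{n+1}=(t+n)\,(t)_n$, and let $$ {}_2F_1(p,q;r;x)=\sum_{n\ge 0}\frac{(p)_n(q)_n}{n!\,(r)_n}x^n,\qquad {}_3F_2(A,B,C;D,E;x)=\sum_{n\ge 0}\frac{(A)_n(B)_n(C)_n}{n!\,(D)_n(E)_n}x^n .$$ Let $P$ be the set of all $v=(a,b,p,q,r)^T\in\mathbb{R}^5$ such that $r\notin\{0,-1,-2,\dots\}$, ${}_2F_1(p,q;r;x)>0$ for all $x\in(0,1)$, and $a>0$, $b>0$, $r+b-p-q>0$. For $v\in P$ the beta-hypergeometric distribution is $$BH(v)(dx)=\frac{x^{a-1}(1-x)^{b-1}\,{}_2F_1(p,q;r;x)}{B(a,b)\,{}_3F_2(a,p,q;r,a+b;1)}\mathbf 1_{(0,1)}(x)\,dx ,$$ and for $c,d>0$ the beta distribution of the second kind is $$\beta^{(2)}_{c,d}(dw)=\frac{1}{B(c,d)}\frac{w^{c-1}}{(1+w)^{c+d}}\mathbf 1_{(0,\infty)}(w)\,dw ,$$ where $B(c,d)=\Gamma(c)\Gamma(d)/\Gamma(c+d)$.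 **Theorem 3.2 (Basic identity).** Let $v=(a,b,p,q,r)^T\in P$ with $a+b-p>0$ and $r-a>0$, and let $$M=\begin{pmatrix}-1&0&0&0&1\\1&1&-1&0&0\\0&1&-1&-1&1\\0&1&0&0&0\\0&1&0&-1&1\end{pmatrix},\qquad \Pi=\begin{pmatrix}1&1&-1&0&0\\-1&0&0&0&1\end{pmatrix}.$$ Then $Mv\in P$. Moreover, if $X\sim BH(v)$ and $W\sim\beta^{(2)}_{\Pi v}$ are independent random variables, where $\beta^{(2)}_{\Pi v}=\beta^{(2)}_{a+b-p,\;r-a}$, then $\frac{1}{1+XW}\sim BH(Mv)$. -/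

import Mathlib

open MeasureTheory ProbabilityTheory Set Matrix

noncomputable section

/-- The generalized hypergeometric series
`₃F₂(A, B, C; D, E; x) = ∑ (A)ₙ (B)ₙ (C)ₙ / (n! (D)ₙ (E)ₙ) xⁿ`. -/
def genHyp32 (A B C D E x : ℝ) : ℝ :=
  ∑' n : ℕ, ((ascPochhammer ℝ n).eval A * (ascPochhammer ℝ n).eval B * (ascPochhammer ℝ n).eval C) /
    ((n.factorial : ℝ) * (ascPochhammer ℝ n).eval D * (ascPochhammer ℝ n).eval E) * x ^ n

/-- The triples `(p, q, r)` such that `r` is not in `{0, -1, -2, …}` and the Gauss hypergeometric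
function `₂F₁(p, q; r; ·)` is positive on `(0, 1)`. -/
def hypPos : Set (ℝ × ℝ × ℝ) :=
  {t | (∀ n : ℕ, t.2.2 ≠ -(n : ℝ)) ∧
    ∀ x ∈ Ioo (0 : ℝ) 1, 0 < ordinaryHypergeometric t.1 t.2.1 t.2.2 x}

/-- The parameter set `P` of the vectors `v = (a, b, p, q, r)` for which the beta-hypergeometric
distribution is defined: `(p, q, r) ∈ hypPos`, and `a`, `b`, `r + b - p - q` are positive. -/
def paramP : Set (Fin 5 → ℝ) :=
  {v | (v 2, v 3, v 4) ∈ hypPos ∧ 0 < v 0 ∧ 0 < v 1 ∧ 0 < v 4 + v 1 - v 2 - v 3}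

/-- The density of the beta-hypergeometric distribution with parameters `v = (a, b, p, q, r)`
at a point `x` of `(0, 1)`:
`x ^ (a - 1) (1 - x) ^ (b - 1) ₂F₁(p, q; r; x) / (B(a, b) ₃F₂(a, p, q; r, a + b; 1))`. -/
def bhDensity (v : Fin 5 → ℝ) (x : ℝ) : ℝ :=
  x ^ (v 0 - 1) * (1 - x) ^ (v 1 - 1) * ordinaryHypergeometric (v 2) (v 3) (v 4) x /
    (beta (v 0) (v 1) * genHyp32 (v 0) (v 2) (v 3) (v 4) (v 0 + v 1) 1)

/-- The beta-hypergeometric distribution `BH(v)` on `(0, 1)`, meaningful for `v ∈ paramP`. -/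
def BH (v : Fin 5 → ℝ) : Measure ℝ :=
  (volume.restrict (Ioo 0 1)).withDensity fun x => ENNReal.ofReal (bhDensity v x)

/-- The beta distribution of the second kind with parameters `c, d > 0`, given as a pair `![c, d]`:
its density on `(0, ∞)` is `w ^ (c - 1) / (B(c, d) (1 + w) ^ (c + d))`. -/
def betaSecondKind (u : Fin 2 → ℝ) : Measure ℝ :=
  (volume.restrict (Ioi 0)).withDensity fun w =>
    ENNReal.ofReal (1 / beta (u 0) (u 1) * (w ^ (u 0 - 1) / (1 + w) ^ (u 0 + u 1)))

/-- The matrix `M`. -/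
def matM : Matrix (Fin 5) (Fin 5) ℝ :=
  !![-1, 0,  0,  0, 1;
      1, 1, -1,  0, 0;
      0, 1, -1, -1, 1;
      0, 1,  0,  0, 0;
      0, 1,  0, -1, 1]

/-- The matrix `Π`. -/
def matPi : Matrix (Fin 2) (Fin 5) ℝ :=
  !![ 1, 1, -1, 0, 0;
     -1, 0,  0, 0, 1]

end

open Filter Topology
open scoped ENNReal

/-! For fixed `x`, put `w = (1 - y) / (x y)`, so that `y = 1 / (1 + x w)`. In the joint density the
powers of `x` and `y` regroup (`rpow_kernel_identity`) into `y ^ (r-a-1) (1-y) ^ (a+b-p-1)` times `x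
^ (r-1) (1-x) ^ (b-1) ₂F₁(p,q;r;x) (1 - y(1-x)) ^ (-(r+b-p))`. It remains to integrate the second
factor over `x`.

Expand the last power as a binomial series in `y(1-x)`. Its `k`-th term raises `b` to `b+k`, which
by a contiguity relation multiplies the integral by `(b)ₖ (r+b-p-q)ₖ / ((r+b-p)ₖ (r+b-q)ₖ)`. The
binomial coefficient `(r+b-p)ₖ / k!` cancels `(r+b-p)ₖ`, and what remains is `₂F₁(r+b-p-q, b; r+b-q;
y)`: the law of `1/(1+XW)` is proportional to `BH(Mv)`. Since both are probability measures, the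
constant is `1`.

The contiguity relation is Gauss's summation in disguise: the exponent `r-1` of `x` cancels `(r)ₙ`,
and the difference of the two series telescopes. Its positivity also yields `r+b-q > 0`, which is
not assumed but is needed for `Mv ∈ P`. -/

/-! ### Raabe's test -/

/-- The ratio is `1 - (1+δ)/n + o(1/n)`. Besides summability, the limit of `n * T n` is recorded
because it is the boundary term of a telescoping sum below. -/
theorem summable_and_tendsto_of_ratio {T ρ : ℕ → ℝ} {δ : ℝ} (hδ : 0 < δ)
    (hT : ∀ n, T (n + 1) = T n * ρ n)
    (hρ : Tendsto (fun n : ℕ => (n + 1) * ρ n - n) atTop (𝓝 (-δ))) :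
    Summable (fun n => |T n|) ∧ Tendsto (fun n : ℕ => n * T n) atTop (𝓝 0) := by
  have hsum : Summable (fun n => |T n|) := by
    have h1 : ∀ᶠ n : ℕ in atTop, (n + 1) * ρ n - n < -(δ / 2) :=
      hρ.eventually_lt_const (by linarith)
    have h2 : ∀ᶠ n : ℕ in atTop, -(2 * δ) < (n + 1) * ρ n - n :=
      hρ.eventually_const_lt (by linarith)
    have h3 : ∀ᶠ n : ℕ in atTop, 2 * δ ≤ n :=
      tendsto_natCast_atTop_atTop.eventually_ge_atTop _
    obtain ⟨N, hN⟩ := eventually_atTop.1 (h1.and (h2.and h3))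
    -- Summing this telescopes and bounds `δ/2` times the partial sums of `|T n|` by `N * |T N|`.
    have hstep : ∀ n ≥ N, ((n : ℝ) + 1) * |T (n + 1)| + δ / 2 * |T n| ≤ n * |T n| := by
      intro n hn
      obtain ⟨h1, h2, h3⟩ := hN n hn
      have hn0 : (0 : ℝ) < n + 1 := by positivity
      have hρ0 : 0 ≤ ρ n := by
        have : 0 < (n + 1) * ρ n := by linarith
        exact (pos_of_mul_pos_right this hn0.le).le
      rw [hT, abs_mul, abs_of_nonneg hρ0]
      nlinarith [abs_nonneg (T n)]
    rw [← summable_nat_add_iff N]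
    refine summable_of_sum_range_le (c := (N * |T N|) / (δ / 2)) (fun n => abs_nonneg _) ?_
    intro k
    rw [le_div_iff₀ (by positivity)]
    have : ∀ k : ℕ, (∑ i ∈ Finset.range k, |T (i + N)|) * (δ / 2) + (k + N : ℕ) * |T (k + N)| ≤
        N * |T N| := by
      intro k
      induction k with
      | zero => simp
      | succ k ih =>
        rw [Finset.sum_range_succ]
        have := hstep (k + N) (by omega)
        rw [show k + 1 + N = k + N + 1 by ring]
        push_cast at this ih ⊢
        linarith
    have h := this k
    have : 0 ≤ ((k + N : ℕ) : ℝ) * |T (k + N)| := by positivity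
    linarith
  refine ⟨hsum, ?_⟩
  have hsumT : Summable T := hsum.of_abs
  have hsumE : Summable (fun n : ℕ => ((n + 1) * ρ n - n) * T n) := by
    refine summable_of_isBigO_nat hsum ?_
    have := (hρ.isBigO_one ℝ).mul (Asymptotics.isBigO_refl (fun n => T n) atTop)
    simpa using this.norm_right
  -- The increments of `n * T n` are a bounded factor times `T n`, so `n * T n` converges; a nonzero
  -- limit would make the harmonic series converge.
  have htel : ∀ n : ℕ, ∑ k ∈ Finset.range n, (((k : ℝ) + 1) * ρ k - k) * T k = n * T n := by
    intro n
    induction n with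
    | zero => simp
    | succ n ih => rw [Finset.sum_range_succ, ih, hT]; push_cast; ring
  obtain ⟨l, hl⟩ := hsumE
  have hlim : Tendsto (fun n : ℕ => n * T n) atTop (𝓝 l) := by
    simpa only [htel] using hl.tendsto_sum_nat
  rcases eq_or_ne l 0 with rfl | hl0
  · exact hlim
  exfalso
  apply Real.not_summable_one_div_natCast
  refine summable_of_isBigO_nat hsumT ?_
  have hinv := ((hlim.inv₀ hl0).isBigO_one ℝ).mul (Asymptotics.isBigO_refl (fun n => T n) atTop)
  refine (Asymptotics.IsBigO.congr' hinv ?_ (by simp)).trans (Asymptotics.isBigO_refl _ _)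
  have hne : ∀ᶠ n : ℕ in atTop, (n : ℝ) * T n ≠ 0 := hlim.eventually_ne hl0
  filter_upwards [hne] with n hn
  have := left_ne_zero_of_mul hn
  have := right_ne_zero_of_mul hn
  field_simp

/-! ### Term-by-term Beta integrals and contiguity -/

theorem ordinaryHypergeometricCoefficient_succ {p q r : ℝ} (n : ℕ) :
    ordinaryHypergeometricCoefficient p q r (n + 1) =
      ordinaryHypergeometricCoefficient p q r n * ((p + n) * (q + n) / ((n + 1) * (r + n))) := by
  simp only [ordinaryHypergeometricCoefficient, ascPochhammer_succ_eval, Nat.factorial_succ]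
  push_cast
  simp only [mul_inv, div_eq_mul_inv]
  ring

theorem beta_add_one_left {a b : ℝ} (ha : 0 < a) (hb : 0 < b) :
    beta (a + 1) b = beta a b * (a / (a + b)) := by
  have := (Real.Gamma_pos_of_pos (add_pos ha hb)).ne'
  rw [beta, beta, Real.Gamma_add_one ha.ne', show a + 1 + b = a + b + 1 by ring,
    Real.Gamma_add_one (by positivity)]
  field_simp

theorem beta_add_one_right {a b : ℝ} (ha : 0 < a) (hb : 0 < b) :
    beta a (b + 1) = beta a b * (b / (a + b)) := by
  have := (Real.Gamma_pos_of_pos (add_pos ha hb)).ne'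
  rw [beta, beta, Real.Gamma_add_one hb.ne', ← add_assoc, Real.Gamma_add_one (by positivity)]
  field_simp

theorem beta_add_nat_left {a b : ℝ} (ha : 0 < a) (hb : 0 < b) (n : ℕ) :
    beta (a + n) b =
      beta a b * ((ascPochhammer ℝ n).eval a / (ascPochhammer ℝ n).eval (a + b)) := by
  induction n with
  | zero => simp
  | succ n ih =>
    have := (ascPochhammer_pos n _ (add_pos ha hb)).ne'
    rw [Nat.cast_succ, ← add_assoc, beta_add_one_left (by positivity) hb, ih,
      ascPochhammer_succ_eval, ascPochhammer_succ_eval, add_right_comm a _ b]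
    field_simp

/-- The `n`-th term of the Beta integral of the series `₂F₁(p, q; r; ·)`. -/
noncomputable def betaHypTerm (a b p q r : ℝ) (n : ℕ) : ℝ :=
  ordinaryHypergeometricCoefficient p q r n * beta (a + n) b

theorem betaHypTerm_succ {a b p q r : ℝ} (ha : 0 < a) (hb : 0 < b) (n : ℕ) :
    betaHypTerm a b p q r (n + 1) = betaHypTerm a b p q r n *
      ((p + n) * (q + n) * (a + n) / ((n + 1) * (r + n) * (a + b + n))) := by
  rw [betaHypTerm, betaHypTerm, ordinaryHypergeometricCoefficient_succ, Nat.cast_succ,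
    ← add_assoc, beta_add_one_left (by positivity) hb, add_right_comm a _ b]
  simp only [mul_inv, div_eq_mul_inv]
  ring

theorem tendsto_betaHypTerm_ratio (a p q r c : ℝ) (hr : ∀ n : ℕ, r ≠ -n) (hc : 0 < c) :
    Tendsto (fun n : ℕ => ((n : ℝ) + 1) *
      ((p + n) * (q + n) * (a + n) / ((n + 1) * (r + n) * (c + n))) - n) atTop
      (𝓝 (-(r + c - a - p - q))) := by
  have h0 : Tendsto (fun n : ℕ => 1 / (n : ℝ)) atTop (𝓝 0) := tendsto_one_div_atTop_nhds_zero_nat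
  -- The expression rewritten as a rational function of `t = 1/n`, regular at `0`.
  have hcont : ContinuousAt (fun t : ℝ => (-(r + c - a - p - q) +
      (p * q + p * a + q * a - r * c) * t + p * q * a * t ^ 2) / ((r * t + 1) * (c * t + 1))) 0 :=
    ContinuousAt.div (by fun_prop) (by fun_prop) (by simp)
  have := hcont.tendsto.comp h0
  simp only [mul_zero, add_zero, zero_add, mul_one, div_one, ne_eq, OfNat.ofNat_ne_zero,
    not_false_eq_true, zero_pow] at this
  refine this.congr' ?_
  filter_upwards [eventually_gt_atTop 0] with n hn
  have hn' : (n : ℝ) ≠ 0 := by positivity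
  have h1 : r + n ≠ 0 := fun h => hr n (by linarith)
  have h2 : c + n ≠ 0 := by positivity
  simp only [Function.comp]
  field_simp
  ring

theorem summable_abs_betaHypTerm {a b p q r : ℝ} (ha : 0 < a) (hb : 0 < b)
    (hr : ∀ n : ℕ, r ≠ -n) (h : 0 < r + b - p - q) :
    Summable (fun n => |betaHypTerm a b p q r n|) ∧
      Tendsto (fun n : ℕ => n * betaHypTerm a b p q r n) atTop (𝓝 0) := by
  refine summable_and_tendsto_of_ratio h (fun n => betaHypTerm_succ ha hb n) ?_
  convert tendsto_betaHypTerm_ratio a p q r (a + b) hr (by positivity) using 2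
  ring_nf

theorem tsum_betaHypTerm {a b p q r : ℝ} (ha : 0 < a) (hb : 0 < b) :
    ∑' n, betaHypTerm a b p q r n = beta a b * genHyp32 a p q r (a + b) 1 := by
  rw [genHyp32, ← tsum_mul_left]
  refine tsum_congr fun n => ?_
  rw [betaHypTerm, beta_add_nat_left ha hb, ordinaryHypergeometricCoefficient]
  simp only [mul_inv, div_eq_mul_inv, one_pow]
  ring

/-- Contiguity in the parameter `b` for the series summing `∫ x ^ (r - 1) (1 - x) ^ (b - 1) ₂F₁`. -/
theorem tsum_betaHypTerm_contiguous {b p q r : ℝ} (hr : 0 < r) (hb : 0 < b)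
    (h : 0 < r + b - p - q) :
    (r + b - p) * (r + b - q) * ∑' n, betaHypTerm r (b + 1) p q r n =
      b * (r + b - p - q) * ∑' n, betaHypTerm r b p q r n := by
  have hr' : ∀ n : ℕ, r ≠ -n := fun n => by have : (0 : ℝ) ≤ n := by positivity
                                            linarith
  obtain ⟨hs, ht⟩ := summable_abs_betaHypTerm (a := r) hr hb hr' h
  obtain ⟨hs', -⟩ := summable_abs_betaHypTerm (a := r) (b := b + 1) (p := p) (q := q) hr
    (by positivity) hr' (by linarith)
  have hs := hs.of_abs
  have hs' := hs'.of_abs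
  have key : HasSum (fun n => (r + b - p) * (r + b - q) * betaHypTerm r (b + 1) p q r n -
      b * (r + b - p - q) * betaHypTerm r b p q r n) 0 := by
    have hsum := (hs'.mul_left ((r + b - p) * (r + b - q))).sub
      (hs.mul_left (b * (r + b - p - q)))
    rw [hsum.hasSum_iff_tendsto_nat]
    -- Since `a = r`, the term ratio reduces to `(p+n)(q+n) / ((n+1)(r+b+n))`, which makes the
    -- combination a difference of consecutive values of `b * (n * betaHypTerm r b p q r n)`.
    have htel : ∀ n : ℕ, ∑ k ∈ Finset.range n, ((r + b - p) * (r + b - q) *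
        betaHypTerm r (b + 1) p q r k - b * (r + b - p - q) * betaHypTerm r b p q r k) =
        b * (n * betaHypTerm r b p q r n) := by
      intro n
      induction n with
      | zero => simp
      | succ n ih =>
        rw [Finset.sum_range_succ, ih, betaHypTerm_succ hr hb]
        have h1 : betaHypTerm r (b + 1) p q r n =
            betaHypTerm r b p q r n * (b / (r + n + b)) := by
          rw [betaHypTerm, betaHypTerm, beta_add_one_right (by positivity) hb]
          ring
        rw [h1]
        have : r + b + n ≠ 0 := by positivity
        have : r + n + b ≠ 0 := by positivity
        have : r + n ≠ 0 := by positivity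
        push_cast
        rw [show r + n + b = r + b + n by ring]
        field_simp
        ring
    simp only [htel]
    simpa using ht.const_mul b
  have h2 := ((hs'.hasSum.mul_left ((r + b - p) * (r + b - q))).sub
      (hs.hasSum.mul_left (b * (r + b - p - q)))).unique key
  linarith

/-! ### Integrals of the unnormalized density -/

theorem integrable_and_hasSum_integral_tsum {α : Type*} [MeasurableSpace α] {μ : Measure α}
    {F : ℕ → α → ℝ} (hF : ∀ i, Integrable (F i) μ) (hs : Summable fun i => ∫ a, ‖F i a‖ ∂μ) :
    Integrable (fun a => ∑' i, F i a) μ ∧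
      HasSum (fun i => ∫ a, F i a ∂μ) (∫ a, ∑' i, F i a ∂μ) := by
  refine ⟨?_, hasSum_integral_of_summable_integral_norm hF hs⟩
  have hfin : ∫⁻ a, ∑' i, ‖F i a‖ₑ ∂μ < ∞ := by
    rw [lintegral_tsum fun i => (hF i).1.enorm]
    have (i : ℕ) : ∫⁻ a, ‖F i a‖ₑ ∂μ = ENNReal.ofReal (∫ a, ‖F i a‖ ∂μ) := by
      rw [ofReal_integral_norm_eq_lintegral_enorm (hF i)]
    simp only [this]
    rw [← ENNReal.ofReal_tsum_of_nonneg (fun i => integral_nonneg fun a => norm_nonneg _) hs]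
    exact ENNReal.ofReal_lt_top
  refine ⟨?_, lt_of_le_of_lt (lintegral_mono fun a => enorm_tsum_le_tsum_enorm) hfin⟩
  have hae : ∀ᵐ a ∂μ, ∑' i, ‖F i a‖ₑ < ∞ :=
    ae_lt_top' (AEMeasurable.tsum fun i => (hF i).1.enorm) hfin.ne
  refine aestronglyMeasurable_of_tendsto_ae atTop
    (f := fun n a => ∑ i ∈ Finset.range n, F i a) (fun n => ?_) ?_
  · exact Finset.aestronglyMeasurable_fun_sum _ fun i _ => (hF i).1
  · filter_upwards [hae] with a ha
    have : Summable fun i => ‖F i a‖ := by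
      have h : Summable fun i => ‖F i a‖₊ := ENNReal.tsum_coe_ne_top_iff_summable.1 ha.ne
      exact NNReal.summable_coe.2 h
    exact this.of_norm.hasSum.tendsto_sum_nat

theorem integrableOn_beta {a b : ℝ} (ha : 0 < a) (hb : 0 < b) :
    IntegrableOn (fun x : ℝ => x ^ (a - 1) * (1 - x) ^ (b - 1)) (Ioo 0 1) ∧
      ∫ x in Ioo (0 : ℝ) 1, x ^ (a - 1) * (1 - x) ^ (b - 1) = beta a b := by
  have hB := beta_pos ha hb
  have hnn : 0 ≤ᵐ[volume.restrict (Ioo (0 : ℝ) 1)]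
      fun x => 1 / beta a b * x ^ (a - 1) * (1 - x) ^ (b - 1) := by
    filter_upwards [ae_restrict_mem measurableSet_Ioo] with x hx
    have := hx.1
    have : 0 < 1 - x := by linarith [hx.2]
    simp only [Pi.zero_apply]
    positivity
  have hm : Measurable fun x : ℝ => 1 / beta a b * x ^ (a - 1) * (1 - x) ^ (b - 1) := by fun_prop
  have h1 : ∫⁻ x in Ioo (0 : ℝ) 1,
      ENNReal.ofReal (1 / beta a b * x ^ (a - 1) * (1 - x) ^ (b - 1)) = 1 := by
    rw [← lintegral_betaPDF, lintegral_betaPDF_eq_one ha hb]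
  have hint : IntegrableOn (fun x : ℝ => 1 / beta a b * x ^ (a - 1) * (1 - x) ^ (b - 1))
      (Ioo 0 1) := by
    refine ⟨hm.aestronglyMeasurable, ?_⟩
    rw [hasFiniteIntegral_iff_ofReal hnn, h1]
    exact ENNReal.one_lt_top
  have hval : ∫ x in Ioo (0 : ℝ) 1, 1 / beta a b * x ^ (a - 1) * (1 - x) ^ (b - 1) = 1 := by
    rw [integral_eq_lintegral_of_nonneg_ae hnn hm.aestronglyMeasurable, h1, ENNReal.toReal_one]
  have heq : (fun x : ℝ => x ^ (a - 1) * (1 - x) ^ (b - 1)) =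
      fun x => beta a b * (1 / beta a b * x ^ (a - 1) * (1 - x) ^ (b - 1)) := by
    funext x
    field_simp
  rw [heq]
  refine ⟨hint.const_mul _, ?_⟩
  rw [integral_const_mul, hval, mul_one]

/-- The unnormalized density of the beta-hypergeometric distribution. -/
noncomputable def bhWeight (a b p q r x : ℝ) : ℝ :=
  x ^ (a - 1) * (1 - x) ^ (b - 1) * ordinaryHypergeometric p q r x

/-- The coefficients of `₂F₁` may change sign, so termwise integration rests on absolute summability
of the Beta integrals, which is where `r + b - p - q > 0` enters. -/
theorem integrableOn_bhWeight {a b p q r : ℝ} (ha : 0 < a) (hb : 0 < b)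
    (hr : ∀ n : ℕ, r ≠ -n) (h : 0 < r + b - p - q) :
    IntegrableOn (bhWeight a b p q r) (Ioo 0 1) ∧
      ∫ x in Ioo (0 : ℝ) 1, bhWeight a b p q r x = ∑' n, betaHypTerm a b p q r n := by
  have hsm := (summable_abs_betaHypTerm ha hb hr h).1
  let F : ℕ → ℝ → ℝ := fun n x =>
    ordinaryHypergeometricCoefficient p q r n * (x ^ (a + n - 1) * (1 - x) ^ (b - 1))
  have hB (n : ℕ) := integrableOn_beta (a := a + n) (by positivity) hb
  have hF (n : ℕ) : Integrable (F n) (volume.restrict (Ioo 0 1)) := (hB n).1.const_mul _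
  have hFint (n : ℕ) : ∫ x in Ioo (0 : ℝ) 1, F n x = betaHypTerm a b p q r n := by
    rw [integral_const_mul, (hB n).2, betaHypTerm]
  have hFnorm (n : ℕ) : ∫ x in Ioo (0 : ℝ) 1, ‖F n x‖ = |betaHypTerm a b p q r n| := by
    rw [betaHypTerm, abs_mul, abs_of_pos (beta_pos (by positivity) hb), ← (hB n).2,
      ← integral_const_mul]
    refine setIntegral_congr_fun measurableSet_Ioo fun x hx => ?_
    have := hx.1
    have : 0 < 1 - x := by linarith [hx.2]
    have hnn : 0 ≤ x ^ (a + n - 1) * (1 - x) ^ (b - 1) := by positivity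
    change |_ * _| = |_| * _
    rw [abs_mul, abs_of_nonneg hnn]
  obtain ⟨h1, h2⟩ := integrable_and_hasSum_integral_tsum hF (by simpa only [hFnorm] using hsm)
  have hcongr : EqOn (fun x => ∑' n, F n x) (bhWeight a b p q r) (Ioo 0 1) := by
    intro x hx
    simp only [F, bhWeight, ordinaryHypergeometric_eq_tsum, ← tsum_mul_left]
    refine tsum_congr fun n => ?_
    rw [show a + n - 1 = a - 1 + n by ring, Real.rpow_add_natCast hx.1.ne', smul_eq_mul]
    ring
  refine ⟨IntegrableOn.congr_fun h1 hcongr measurableSet_Ioo, ?_⟩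
  rw [← setIntegral_congr_fun measurableSet_Ioo hcongr, ← h2.tsum_eq]
  exact tsum_congr hFint

theorem bhWeight_pos {a b p q r x : ℝ} (hF : 0 < ordinaryHypergeometric p q r x)
    (hx : x ∈ Ioo (0 : ℝ) 1) : 0 < bhWeight a b p q r x := by
  have := hx.1
  have : 0 < 1 - x := by linarith [hx.2]
  unfold bhWeight
  positivity

theorem integral_bhWeight_pos {a b p q r : ℝ} (ha : 0 < a) (hb : 0 < b)
    (hr : ∀ n : ℕ, r ≠ -n) (h : 0 < r + b - p - q)
    (hF : ∀ x ∈ Ioo (0 : ℝ) 1, 0 < ordinaryHypergeometric p q r x) :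
    0 < ∫ x in Ioo (0 : ℝ) 1, bhWeight a b p q r x := by
  rw [setIntegral_pos_iff_support_of_nonneg_ae]
  · have : Function.support (bhWeight a b p q r) ∩ Ioo 0 1 = Ioo 0 1 :=
      inter_eq_right.2 fun x hx => (bhWeight_pos (hF x hx) hx).ne'
    rw [this]
    simp
  · filter_upwards [ae_restrict_mem measurableSet_Ioo] with x hx
    exact (bhWeight_pos (hF x hx) hx).le
  · exact (integrableOn_bhWeight ha hb hr h).1

theorem integral_bhWeight_contiguous {b p q r : ℝ} (hr : 0 < r) (hb : 0 < b)
    (h : 0 < r + b - p - q) :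
    (r + b - p) * (r + b - q) * ∫ x in Ioo (0 : ℝ) 1, bhWeight r (b + 1) p q r x =
      b * (r + b - p - q) * ∫ x in Ioo (0 : ℝ) 1, bhWeight r b p q r x := by
  have hr' : ∀ n : ℕ, r ≠ -n := fun n => by
    have : (0 : ℝ) ≤ n := by positivity
    linarith
  rw [(integrableOn_bhWeight hr hb hr' h).2,
    (integrableOn_bhWeight hr (by positivity) hr' (by linarith)).2,
    tsum_betaHypTerm_contiguous hr hb h]

/-- Iterated contiguity. Positivity of `r+b-p` and `r+b-q` keeps every divisor nonzero. -/
theorem integral_bhWeight_add_nat {b p q r : ℝ} (hr : 0 < r) (hb : 0 < b)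
    (h : 0 < r + b - p - q) (hp : 0 < r + b - p) (hq : 0 < r + b - q) (k : ℕ) :
    ∫ x in Ioo (0 : ℝ) 1, bhWeight r (b + k) p q r x =
      (ascPochhammer ℝ k).eval b * (ascPochhammer ℝ k).eval (r + b - p - q) /
        ((ascPochhammer ℝ k).eval (r + b - p) * (ascPochhammer ℝ k).eval (r + b - q)) *
      ∫ x in Ioo (0 : ℝ) 1, bhWeight r b p q r x := by
  induction k with
  | zero => simp
  | succ k ih =>
    have := integral_bhWeight_contiguous (b := b + k) (p := p) (q := q) hr (by positivity) (by
      have : (0 : ℝ) ≤ k := by positivity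
      linarith)
    have hk1 := (ascPochhammer_pos k _ hp).ne'
    have hk2 := (ascPochhammer_pos k _ hq).ne'
    have h1 : r + b - p + k ≠ 0 := by positivity
    have h2 : r + b - q + k ≠ 0 := by positivity
    simp only [ascPochhammer_succ_eval, Nat.cast_succ, ← add_assoc]
    rw [ih, show r + (b + k) - p = r + b - p + k by ring,
      show r + (b + k) - q = r + b - q + k by ring,
      show r + b - p + k - q = r + b - p - q + k by ring] at this
    rw [← mul_right_inj' (mul_ne_zero h1 h2), this]
    field_simp

/-! ### Positive power series and the integral over `x` -/

theorem ordinaryHypergeometric_term_pos {p q r x : ℝ} (hp : 0 < p) (hq : 0 < q) (hr : 0 < r)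
    (hx : 0 < x) (n : ℕ) : 0 < ordinaryHypergeometricCoefficient p q r n * x ^ n := by
  have := ascPochhammer_pos n _ hp
  have := ascPochhammer_pos n _ hq
  have := ascPochhammer_pos n _ hr
  unfold ordinaryHypergeometricCoefficient
  positivity

theorem ordinaryHypergeometric_hasSum {p q r x : ℝ} (hp : 0 < p) (hq : 0 < q) (hr : 0 < r)
    (hx : x ∈ Ioo (0 : ℝ) 1) :
    HasSum (fun n => ordinaryHypergeometricCoefficient p q r n * x ^ n)
      (ordinaryHypergeometric p q r x) := by
  have hrad : (ordinaryHypergeometricSeries ℝ p q r).radius = 1 := by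
    refine ordinaryHypergeometricSeries_radius_eq_one ℝ p q r fun k => ?_
    have : (0 : ℝ) ≤ k := by positivity
    refine ⟨?_, ?_, ?_⟩ <;> linarith
  have hmem : x ∈ Metric.eball (0 : ℝ) (ordinaryHypergeometricSeries ℝ p q r).radius := by
    rw [hrad, ← ENNReal.ofReal_one, Metric.eball_ofReal]
    simp [abs_of_pos hx.1, hx.2]
  have := (ordinaryHypergeometricSeries ℝ p q r).hasSum hmem
  simp only [ordinaryHypergeometricSeries_apply_eq, smul_eq_mul] at this
  exact this

theorem ordinaryHypergeometric_pos {p q r x : ℝ} (hp : 0 < p) (hq : 0 < q) (hr : 0 < r)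
    (hx : x ∈ Ioo (0 : ℝ) 1) : 0 < ordinaryHypergeometric p q r x := by
  have h := ordinaryHypergeometric_hasSum hp hq hr hx
  rw [← h.tsum_eq]
  exact h.summable.tsum_pos (fun n => (ordinaryHypergeometric_term_pos hp hq hr hx.1 n).le) 0
    (ordinaryHypergeometric_term_pos hp hq hr hx.1 0)

theorem hasSum_one_sub_rpow_neg (s : ℝ) {z : ℝ} (hz : z ∈ Ioo (0 : ℝ) 1) :
    HasSum (fun n : ℕ => (ascPochhammer ℝ n).eval s / n.factorial * z ^ n) (1 / (1 - z) ^ s) := by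
  have := (Real.one_div_one_sub_rpow_hasFPowerSeriesOnBall_zero s).hasSum (y := z) (by
    rw [← ENNReal.ofReal_one, Metric.eball_ofReal]
    simp [abs_of_pos hz.1, hz.2])
  simp only [zero_add, FormalMultilinearSeries.ofScalars_apply_eq, smul_eq_mul] at this
  have hc (n : ℕ) : (ascPochhammer ℝ n).eval s / n.factorial = Ring.choose (s + n - 1) n := by
    rw [div_eq_iff (by positivity), ← Polynomial.ascPochhammer_smeval_eq_eval,
      ← Ring.factorial_nsmul_multichoose_eq_ascPochhammer, ← Ring.multichoose_eq]
    simp [mul_comm]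
  simpa only [hc] using this

/-- Binomial expansion in `y(1-x)`, then contiguity for each term. All terms are nonnegative, so sum
and integral interchange without further estimates. -/
theorem lintegral_bhWeight_mul_one_sub_rpow {b p q r y : ℝ} (hr : 0 < r) (hb : 0 < b)
    (h : 0 < r + b - p - q) (hp : 0 < r + b - p) (hq : 0 < r + b - q)
    (hF : ∀ x ∈ Ioo (0 : ℝ) 1, 0 < ordinaryHypergeometric p q r x) (hy : y ∈ Ioo (0 : ℝ) 1) :
    ∫⁻ x in Ioo (0 : ℝ) 1,
        ENNReal.ofReal (bhWeight r b p q r x * (1 / (1 - y * (1 - x)) ^ (r + b - p))) =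
      ENNReal.ofReal ((∫ x in Ioo (0 : ℝ) 1, bhWeight r b p q r x) *
        ordinaryHypergeometric (r + b - p - q) b (r + b - q) y) := by
  have hr' : ∀ n : ℕ, r ≠ -n := fun n => by
    have : (0 : ℝ) ≤ n := by positivity
    linarith
  let g : ℕ → ℝ := fun n => (ascPochhammer ℝ n).eval (r + b - p) / n.factorial * y ^ n
  have hy0 := hy.1
  have hg (n : ℕ) : 0 ≤ g n := by
    have := ascPochhammer_pos n _ hp
    positivity
  have hI (n : ℕ) : IntegrableOn (bhWeight r (b + n) p q r) (Ioo 0 1) :=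
    (integrableOn_bhWeight hr (by positivity) hr' (by
      have : (0 : ℝ) ≤ n := by positivity
      linarith)).1
  have hnn (n : ℕ) : ∀ x ∈ Ioo (0 : ℝ) 1, 0 ≤ g n * bhWeight r (b + n) p q r x := fun x hx =>
    mul_nonneg (hg n) (bhWeight_pos (hF x hx) hx).le
  have hexp : ∀ x ∈ Ioo (0 : ℝ) 1,
      ENNReal.ofReal (bhWeight r b p q r x * (1 / (1 - y * (1 - x)) ^ (r + b - p))) =
        ∑' n, ENNReal.ofReal (g n * bhWeight r (b + n) p q r x) := by
    intro x hx
    have hx1 : 0 < 1 - x := by linarith [hx.2]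
    have hz : y * (1 - x) ∈ Ioo (0 : ℝ) 1 := ⟨by positivity, by nlinarith [hx.1, hy.2]⟩
    have hs := (hasSum_one_sub_rpow_neg (r + b - p) hz).mul_left (bhWeight r b p q r x)
    have hs' : HasSum (fun n => g n * bhWeight r (b + n) p q r x)
        (bhWeight r b p q r x * (1 / (1 - y * (1 - x)) ^ (r + b - p))) := by
      refine hs.congr_fun fun n => ?_
      simp only [g, bhWeight]
      rw [show b + n - 1 = b - 1 + n by ring, Real.rpow_add_natCast hx1.ne', mul_pow]
      ring
    rw [← hs'.tsum_eq, ENNReal.ofReal_tsum_of_nonneg (fun n => hnn n x hx) hs'.summable]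
  rw [setLIntegral_congr_fun measurableSet_Ioo hexp,
    lintegral_tsum fun n => ((hI n).const_mul (g n)).aemeasurable.ennreal_ofReal]
  have hterm (n : ℕ) : ∫⁻ x in Ioo (0 : ℝ) 1, ENNReal.ofReal (g n * bhWeight r (b + n) p q r x) =
      ENNReal.ofReal ((∫ x in Ioo (0 : ℝ) 1, bhWeight r b p q r x) *
        (ordinaryHypergeometricCoefficient (r + b - p - q) b (r + b - q) n * y ^ n)) := by
    rw [← ofReal_integral_eq_lintegral_ofReal ((hI n).const_mul (g n))
      ((ae_restrict_mem measurableSet_Ioo).mono (hnn n)), integral_const_mul,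
      integral_bhWeight_add_nat hr hb h hp hq]
    have := (ascPochhammer_pos n _ hp).ne'
    have := (ascPochhammer_pos n _ hq).ne'
    congr 1
    simp only [g, ordinaryHypergeometricCoefficient]
    field_simp
  have hs := (ordinaryHypergeometric_hasSum h hb hq hy).mul_left
    (∫ x in Ioo (0 : ℝ) 1, bhWeight r b p q r x)
  simp only [hterm]
  rw [← hs.tsum_eq, ENNReal.ofReal_tsum_of_nonneg (fun n => ?_) hs.summable]
  exact mul_nonneg (integral_bhWeight_pos hr hb hr' h hF).le
    (ordinaryHypergeometric_term_pos h hb hq hy.1 n).le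

/-! ### Change of variables from `w` to `y` -/

theorem lintegral_Ioi_eq_lintegral_Ioo_one_sub_div {x : ℝ} (hx : 0 < x) (g : ℝ → ℝ≥0∞) :
    ∫⁻ w in Ioi 0, g w =
      ∫⁻ y in Ioo (0 : ℝ) 1, ENNReal.ofReal (1 / (x * y ^ 2)) * g ((1 - y) / (x * y)) := by
  have himg : (fun y : ℝ => (1 - y) / (x * y)) '' Ioo 0 1 = Ioi 0 := by
    ext w
    constructor
    · rintro ⟨y, ⟨h0, h1⟩, rfl⟩
      have : 0 < 1 - y := by linarith
      exact div_pos this (by positivity)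
    · intro hw
      have hw : 0 < w := hw
      have : 0 < x * w := by positivity
      refine ⟨1 / (1 + x * w), ⟨by positivity, ?_⟩, ?_⟩
      · rw [div_lt_one (by positivity)]
        linarith
      · field_simp
        ring
  have hderiv : ∀ y ∈ Ioo (0 : ℝ) 1, HasDerivWithinAt (fun y : ℝ => (1 - y) / (x * y))
      (-(1 / (x * y ^ 2))) (Ioo 0 1) y := by
    intro y hy
    have hy0 := hy.1
    have h := ((hasDerivAt_id y).const_sub 1).div ((hasDerivAt_id y).const_mul x)
      (by simp only [id]; positivity)
    refine (h.congr_deriv ?_).hasDerivWithinAt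
    simp only [id]
    field_simp
    ring
  have hinj : InjOn (fun y : ℝ => (1 - y) / (x * y)) (Ioo 0 1) := by
    intro y hy z hz h
    have := hy.1
    have := hz.1
    simp only at h
    field_simp at h
    linarith
  rw [← himg, lintegral_image_eq_lintegral_abs_deriv_mul measurableSet_Ioo hderiv hinj]
  refine setLIntegral_congr_fun measurableSet_Ioo fun y hy => ?_
  have := hy.1
  simp only [abs_neg]
  rw [abs_of_pos (by positivity)]

theorem rpow_kernel_identity {a b p r x y F : ℝ} (hx : x ∈ Ioo (0 : ℝ) 1)
    (hy : y ∈ Ioo (0 : ℝ) 1) :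
    x ^ (a - 1) * (1 - x) ^ (b - 1) * F * (1 / (x * y ^ 2) *
      (((1 - y) / (x * y)) ^ (a + b - p - 1) /
        (1 + (1 - y) / (x * y)) ^ (a + b - p + (r - a)))) =
      y ^ (r - a - 1) * (1 - y) ^ (a + b - p - 1) *
        (x ^ (r - 1) * (1 - x) ^ (b - 1) * F * (1 / (1 - y * (1 - x)) ^ (r + b - p))) := by
  have hx0 := hx.1
  have hy0 := hy.1
  have hx1 : 0 < 1 - x := by linarith [hx.2]
  have hy1 : 0 < 1 - y := by linarith [hy.2]
  have hD : 0 < 1 - y * (1 - x) := by nlinarith [hy.2]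
  have h1 : 1 + (1 - y) / (x * y) = (1 - y * (1 - x)) / (x * y) := by
    field_simp
    ring
  -- All exponents are split over common powers so that `field_simp` can treat the remaining real
  -- powers as atoms.
  have hxs : x ^ (r + b - p) = x ^ (r - a) * x ^ (a + b - p - 1) * x := by
    rw [← Real.rpow_add hx0, ← Real.rpow_add_one hx0.ne']
    ring_nf
  have hys : y ^ (r + b - p) = y ^ (r - a - 1) * y ^ (a + b - p - 1) * y ^ 2 := by
    rw [← Real.rpow_add hy0, ← Real.rpow_add_natCast hy0.ne']
    push_cast
    ring_nf
  have hxr : x ^ (r - 1) = x ^ (a - 1) * x ^ (r - a) := by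
    rw [← Real.rpow_add hx0]
    ring_nf
  rw [h1, show a + b - p + (r - a) = r + b - p by ring, Real.div_rpow hy1.le (by positivity),
    Real.div_rpow hD.le (by positivity), Real.mul_rpow hx0.le hy0.le,
    Real.mul_rpow hx0.le hy0.le, hxs, hys, hxr]
  have := Real.rpow_pos_of_pos hD (r + b - p)
  have := Real.rpow_pos_of_pos hx0 (a + b - p - 1)
  have := Real.rpow_pos_of_pos hy0 (a + b - p - 1)
  field_simp

/-! ### Normalization, the parameter set and the image law -/

theorem matM_mulVec (v : Fin 5 → ℝ) : matM *ᵥ v =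
    ![v 4 - v 0, v 0 + v 1 - v 2, v 4 + v 1 - v 2 - v 3, v 1, v 4 + v 1 - v 3] := by
  ext i
  fin_cases i <;> simp [matM, Matrix.mulVec, dotProduct, Fin.sum_univ_five] <;> ring

theorem matPi_mulVec (v : Fin 5 → ℝ) : matPi *ᵥ v = ![v 0 + v 1 - v 2, v 4 - v 0] := by
  ext i
  fin_cases i <;> simp [matPi, Matrix.mulVec, dotProduct, Fin.sum_univ_five] <;> ring

/-- The total mass of the unnormalized beta-hypergeometric distribution. -/
noncomputable def bhMass (v : Fin 5 → ℝ) : ℝ :=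
  ∫ x in Ioo (0 : ℝ) 1, bhWeight (v 0) (v 1) (v 2) (v 3) (v 4) x

theorem bhMass_pos {v : Fin 5 → ℝ} (hv : v ∈ paramP) : 0 < bhMass v := by
  obtain ⟨⟨hr, hF⟩, ha, hb, h⟩ := hv
  exact integral_bhWeight_pos ha hb hr h hF

theorem bhDensity_eq {v : Fin 5 → ℝ} (hv : v ∈ paramP) (x : ℝ) :
    bhDensity v x = bhWeight (v 0) (v 1) (v 2) (v 3) (v 4) x / bhMass v := by
  obtain ⟨⟨hr, hF⟩, ha, hb, h⟩ := hv
  rw [bhMass, (integrableOn_bhWeight ha hb hr h).2, tsum_betaHypTerm ha hb]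
  rfl

theorem integrableOn_bhDensity {v : Fin 5 → ℝ} (hv : v ∈ paramP) :
    IntegrableOn (bhDensity v) (Ioo 0 1) := by
  have h : bhDensity v = fun x => bhWeight (v 0) (v 1) (v 2) (v 3) (v 4) x / bhMass v :=
    funext (bhDensity_eq hv)
  obtain ⟨⟨hr, hF⟩, ha, hb, hc⟩ := hv
  rw [h]
  exact (integrableOn_bhWeight ha hb hr hc).1.div_const _

theorem isProbabilityMeasure_BH {v : Fin 5 → ℝ} (hv : v ∈ paramP) :
    IsProbabilityMeasure (BH v) := by
  refine ⟨?_⟩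
  rw [BH, withDensity_apply _ MeasurableSet.univ, setLIntegral_univ,
    ← ofReal_integral_eq_lintegral_ofReal (integrableOn_bhDensity hv)]
  · simp only [bhDensity_eq hv]
    rw [integral_div, ← bhMass, div_self (bhMass_pos hv).ne', ENNReal.ofReal_one]
  · filter_upwards [ae_restrict_mem measurableSet_Ioo] with x hx
    rw [bhDensity_eq hv]
    exact div_nonneg (bhWeight_pos (hv.1.2 x hx) hx).le (bhMass_pos hv).le

/-- In the contiguity relation both integrals are positive, as are `b (r+b-p-q)` and `r+b-p =
(a+b-p) + (r-a)`; this forces the sign of `r+b-q`. -/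
theorem matM_mulVec_pos {v : Fin 5 → ℝ} (hv : v ∈ paramP)
    (h₁ : 0 < v 0 + v 1 - v 2) (h₂ : 0 < v 4 - v 0) : 0 < v 4 + v 1 - v 3 := by
  obtain ⟨⟨hr, hF⟩, ha, hb, h⟩ := hv
  simp only at hr hF
  have hr0 : 0 < v 4 := by linarith
  have hI := integral_bhWeight_pos hr0 hb hr h hF
  have hI' := integral_bhWeight_pos hr0 (b := v 1 + 1) (by positivity) hr (by linarith) hF
  have hc := integral_bhWeight_contiguous hr0 hb h
  have hpos : 0 < v 1 * (v 4 + v 1 - v 2 - v 3) *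
      ∫ x in Ioo (0 : ℝ) 1, bhWeight (v 4) (v 1) (v 2) (v 3) (v 4) x := by positivity
  rw [← hc] at hpos
  have := pos_of_mul_pos_left hpos hI'.le
  exact pos_of_mul_pos_right this (by linarith : 0 ≤ v 4 + v 1 - v 2)

theorem matM_mulVec_mem_paramP {v : Fin 5 → ℝ} (hv : v ∈ paramP)
    (h₁ : 0 < v 0 + v 1 - v 2) (h₂ : 0 < v 4 - v 0) : matM *ᵥ v ∈ paramP := by
  have hq := matM_mulVec_pos hv h₁ h₂
  obtain ⟨-, ha, hb, h⟩ := hv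
  rw [matM_mulVec]
  refine ⟨⟨fun n => ?_, fun x hx => ?_⟩, ?_, ?_, ?_⟩
  · have : (0 : ℝ) ≤ n := by positivity
    simp
    linarith
  · exact ordinaryHypergeometric_pos h hb hq hx
  · simpa using h₂
  · simpa using h₁
  · simp
    linarith

theorem lintegral_kernel {v : Fin 5 → ℝ} (hv : v ∈ paramP)
    (h₁ : 0 < v 0 + v 1 - v 2) (h₂ : 0 < v 4 - v 0) {y : ℝ} (hy : y ∈ Ioo (0 : ℝ) 1) :
    ∫⁻ x in Ioo (0 : ℝ) 1, ENNReal.ofReal (bhDensity v x) *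
      (ENNReal.ofReal (1 / (x * y ^ 2)) *
        ENNReal.ofReal (1 / beta (v 0 + v 1 - v 2) (v 4 - v 0) *
          (((1 - y) / (x * y)) ^ (v 0 + v 1 - v 2 - 1) /
            (1 + (1 - y) / (x * y)) ^ (v 0 + v 1 - v 2 + (v 4 - v 0))))) =
      ENNReal.ofReal (1 / bhMass v * (1 / beta (v 0 + v 1 - v 2) (v 4 - v 0)) *
        ∫ x in Ioo (0 : ℝ) 1, bhWeight (v 4) (v 1) (v 2) (v 3) (v 4) x) *
      ENNReal.ofReal (bhWeight (v 4 - v 0) (v 0 + v 1 - v 2) (v 4 + v 1 - v 2 - v 3) (v 1)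
        (v 4 + v 1 - v 3) y) := by
  have hq := matM_mulVec_pos hv h₁ h₂
  have hmass := bhMass_pos hv
  have hB := beta_pos h₁ h₂
  have hden := bhDensity_eq hv
  obtain ⟨⟨hr, hF⟩, ha, hb, h⟩ := hv
  simp only at hr hF
  have hr0 : 0 < v 4 := by linarith
  have hI := integral_bhWeight_pos hr0 hb hr h hF
  have hy0 := hy.1
  have hy1 : 0 < 1 - y := by linarith [hy.2]
  set B := beta (v 0 + v 1 - v 2) (v 4 - v 0)
  let C : ℝ := 1 / bhMass v * (1 / B) * (y ^ (v 4 - v 0 - 1) * (1 - y) ^ (v 0 + v 1 - v 2 - 1))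
  have hC : 0 ≤ C := by positivity
  have hcongr : ∀ x ∈ Ioo (0 : ℝ) 1, ENNReal.ofReal (bhDensity v x) *
      (ENNReal.ofReal (1 / (x * y ^ 2)) *
        ENNReal.ofReal (1 / B * (((1 - y) / (x * y)) ^ (v 0 + v 1 - v 2 - 1) /
            (1 + (1 - y) / (x * y)) ^ (v 0 + v 1 - v 2 + (v 4 - v 0))))) =
      ENNReal.ofReal C * ENNReal.ofReal (bhWeight (v 4) (v 1) (v 2) (v 3) (v 4) x *
        (1 / (1 - y * (1 - x)) ^ (v 4 + v 1 - v 2))) := by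
    intro x hx
    have hx0 := hx.1
    have hw := bhWeight_pos (a := v 0) (b := v 1) (hF x hx) hx
    rw [← ENNReal.ofReal_mul (by positivity), ← ENNReal.ofReal_mul
      (by rw [hden]; positivity), ← ENNReal.ofReal_mul hC, hden]
    congr 1
    have hid := rpow_kernel_identity (a := v 0) (b := v 1) (p := v 2) (r := v 4)
      (F := ordinaryHypergeometric (v 2) (v 3) (v 4) x) hx hy
    simp only [C, bhWeight]
    linear_combination (1 / bhMass v * (1 / B)) * hid
  rw [setLIntegral_congr_fun measurableSet_Ioo hcongr, lintegral_const_mul' _ _ ENNReal.ofReal_ne_top,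
    lintegral_bhWeight_mul_one_sub_rpow hr0 hb h (by linarith) hq hF hy, ← ENNReal.ofReal_mul hC,
    ← ENNReal.ofReal_mul (by positivity)]
  congr 1
  simp only [C]
  rw [bhWeight]
  ring

instance sFinite_betaSecondKind (u : Fin 2 → ℝ) : SFinite (betaSecondKind u) := by
  unfold betaSecondKind
  infer_instance

/-- The constant is left unspecified: total mass identifies it later, so no Gamma-function
evaluation is needed. -/
theorem map_prod_BH_betaSecondKind {v : Fin 5 → ℝ} (hv : v ∈ paramP)
    (h₁ : 0 < v 0 + v 1 - v 2) (h₂ : 0 < v 4 - v 0) :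
    ∃ c : ℝ≥0∞, ((BH v).prod (betaSecondKind (matPi *ᵥ v))).map
      (fun z : ℝ × ℝ => 1 / (1 + z.1 * z.2)) = c • BH (matM *ᵥ v) := by
  have hv' := matM_mulVec_mem_paramP hv h₁ h₂
  have hmass' := bhMass_pos hv'
  have hden' := bhDensity_eq hv'
  have hint' := integrableOn_bhDensity hv'
  have hker := fun {y : ℝ} (hy : y ∈ Ioo (0 : ℝ) 1) => lintegral_kernel hv h₁ h₂ hy
  have hint := (integrableOn_bhDensity hv).aemeasurable.ennreal_ofReal
  set K := ENNReal.ofReal (1 / bhMass v * (1 / beta (v 0 + v 1 - v 2) (v 4 - v 0)) *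
        ∫ x in Ioo (0 : ℝ) 1, bhWeight (v 4) (v 1) (v 2) (v 3) (v 4) x)
  refine ⟨K * ENNReal.ofReal (bhMass (matM *ᵥ v)), ?_⟩
  refine Measure.ext_of_lintegral _ fun φ hφ => ?_
  rw [lintegral_map hφ (by fun_prop), lintegral_prod _ (by fun_prop), lintegral_smul_measure]
  let h : ℝ → ℝ≥0∞ := fun w => ENNReal.ofReal (1 / beta (v 0 + v 1 - v 2) (v 4 - v 0) *
    (w ^ (v 0 + v 1 - v 2 - 1) / (1 + w) ^ (v 0 + v 1 - v 2 + (v 4 - v 0))))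
  have hh : Measurable h := by fun_prop
  have hbeta : betaSecondKind (matPi *ᵥ v) = (volume.restrict (Ioi 0)).withDensity h := by
    rw [betaSecondKind, matPi_mulVec]
    rfl
  have hinner : ∀ x ∈ Ioo (0 : ℝ) 1,
      ∫⁻ w, φ (1 / (1 + x * w)) ∂betaSecondKind (matPi *ᵥ v) =
        ∫⁻ y in Ioo (0 : ℝ) 1,
          ENNReal.ofReal (1 / (x * y ^ 2)) * h ((1 - y) / (x * y)) * φ y := by
    intro x hx
    rw [hbeta, lintegral_withDensity_eq_lintegral_mul _ hh (by fun_prop),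
      lintegral_Ioi_eq_lintegral_Ioo_one_sub_div hx.1]
    refine setLIntegral_congr_fun measurableSet_Ioo fun y hy => ?_
    have hx0 := hx.1
    have hy0 := hy.1
    have : 1 / (1 + x * ((1 - y) / (x * y))) = y := by
      field_simp
      ring
    simp only [Pi.mul_apply, this, mul_assoc]
  have hmeasφ : AEMeasurable (fun x => ∫⁻ w, φ (1 / (1 + x * w)) ∂betaSecondKind (matPi *ᵥ v))
      (volume.restrict (Ioo (0 : ℝ) 1)) := by
    exact (Measurable.lintegral_prod_right' (f := fun z : ℝ × ℝ => φ (1 / (1 + z.1 * z.2)))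
      (by fun_prop)).aemeasurable
  rw [BH, lintegral_withDensity_eq_lintegral_mul₀ hint hmeasφ]
  have hstep : ∀ x ∈ Ioo (0 : ℝ) 1,
      ((fun x => ENNReal.ofReal (bhDensity v x)) *
        fun x => ∫⁻ w, φ (1 / (1 + x * w)) ∂betaSecondKind (matPi *ᵥ v)) x =
      ∫⁻ y in Ioo (0 : ℝ) 1, ENNReal.ofReal (bhDensity v x) *
        (ENNReal.ofReal (1 / (x * y ^ 2)) * h ((1 - y) / (x * y)) * φ y) := by
    intro x hx
    rw [Pi.mul_apply, hinner x hx, lintegral_const_mul' _ _ ENNReal.ofReal_ne_top]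
  rw [setLIntegral_congr_fun measurableSet_Ioo hstep, lintegral_lintegral_swap, BH,
    lintegral_withDensity_eq_lintegral_mul₀ hint'.aemeasurable.ennreal_ofReal hφ.aemeasurable, smul_eq_mul,
    ← lintegral_const_mul' _ _ (ENNReal.mul_ne_top ENNReal.ofReal_ne_top ENNReal.ofReal_ne_top)]
  · refine setLIntegral_congr_fun measurableSet_Ioo fun y hy => ?_
    have hsplit : ∀ x : ℝ, ENNReal.ofReal (bhDensity v x) *
        (ENNReal.ofReal (1 / (x * y ^ 2)) * h ((1 - y) / (x * y)) * φ y) =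
        φ y * (ENNReal.ofReal (bhDensity v x) *
          (ENNReal.ofReal (1 / (x * y ^ 2)) * h ((1 - y) / (x * y)))) := fun x => by ring
    have hmeas : AEMeasurable (fun x => ENNReal.ofReal (bhDensity v x) *
          (ENNReal.ofReal (1 / (x * y ^ 2)) * h ((1 - y) / (x * y))))
          (volume.restrict (Ioo (0 : ℝ) 1)) :=
      hint.mul (Measurable.aemeasurable (by fun_prop))
    simp only [hsplit, Pi.mul_apply]
    rw [lintegral_const_mul'' _ hmeas, hker hy, mul_assoc K, ← mul_assoc (ENNReal.ofReal _) _ (φ y),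
      ← ENNReal.ofReal_mul hmass'.le, hden', mul_div_cancel₀ _ hmass'.ne', matM_mulVec, mul_comm,
      mul_assoc]
    rfl
  · refine AEMeasurable.mul ?_ (Measurable.aemeasurable ?_)
    · exact hint.comp_fst
    · fun_prop

theorem theorem3p2 (v : Fin 5 → ℝ) (hv : v ∈ paramP)
    (h₁ : 0 < v 0 + v 1 - v 2) (h₂ : 0 < v 4 - v 0) :
    matM *ᵥ v ∈ paramP ∧
      ∀ (Ω : Type*) [MeasurableSpace Ω] (μ : Measure Ω) [IsProbabilityMeasure μ] (X W : Ω → ℝ),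
        HasLaw X (BH v) μ → HasLaw W (betaSecondKind (matPi *ᵥ v)) μ → IndepFun X W μ →
        HasLaw (fun ω => 1 / (1 + X ω * W ω)) (BH (matM *ᵥ v)) μ := by
  have hv' := matM_mulVec_mem_paramP hv h₁ h₂
  refine ⟨hv', fun Ω _ μ _ X W hX hW hXW => ?_⟩
  have hXm := hX.aemeasurable
  have hWm := hW.aemeasurable
  have hYm : AEMeasurable (fun ω => 1 / (1 + X ω * W ω)) μ := by fun_prop
  refine ⟨hYm, ?_⟩
  obtain ⟨c, hc⟩ := map_prod_BH_betaSecondKind hv h₁ h₂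
  have hmap : μ.map (fun ω => 1 / (1 + X ω * W ω)) = c • BH (matM *ᵥ v) := by
    rw [← hc, ← hX.map_eq, ← hW.map_eq,
      ← (indepFun_iff_map_prod_eq_prod_map_map hXm hWm).1 hXW,
      AEMeasurable.map_map_of_aemeasurable (Measurable.aemeasurable (by fun_prop))
        (hXm.prodMk hWm)]
    rfl
  have := isProbabilityMeasure_BH hv'
  have := Measure.isProbabilityMeasure_map hYm
  -- Both measures have total mass `1`.
  have hone : c = 1 := by
    have h1 : (μ.map (fun ω => 1 / (1 + X ω * W ω))) univ = 1 := measure_univ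
    rwa [hmap, Measure.smul_apply, measure_univ, smul_eq_mul, mul_one] at h1
  rw [hmap, hone, one_smul]
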